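/- Let $A$ be a unital $C^*$-algebra and $B\subseteq A$ a $C^*$-subalgebra containing $1_A$. A unital Hilbert bimodule over $A$ is a complex Hilbert space $H$ with commuting unital $*$-representations of $A$ (written $a\cdot\xi$) and of the opposite algebra $A^{\rm op}$ (written $\xi\cdot a$). Put $H^B=\{\xi\in H: b\cdot\xi=\xi\cdot b \text{ for all } b\in B\}$, let $P_H^B$ be the orthogonal projection of $H$ onto $H^B$, and for a non-empty finite set $Q\subseteq A$ and $\beta>0$ let $V_H(Q,\beta)=\{\xi\in H:\|\xi\|=1,\ \|x\cdot\xi-\xi\cdot x\|<\beta \text{ for all } x\in Q\}$. * $A$ has strong property $(T)$ if for every $\gamma>0$ there are a non-empty finite $Q\subseteq A$ and $\beta>0$ such that $\|\xi-P_H^A(\xi)\|<\gamma$ for every unital Hilbert bimodule $H$ over $A$ and every $\xi\in V_H(Q,\beta)$. * The pair $(A,B)$ is strongly co-rigid if for every $\gamma>0$ there are a non-empty finite $Q\subseteq A$ and $\delta>0$ such that $\|\xi-P_H^A(\xi)\|<\gamma$ for every unital Hilbert bimodule $H$ over $A$ and every $\xi\in V_H(Q,\delta)\cap H^B$. * A discrete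 group $\Gamma$ has property $(T)$ if there are a non-empty finite $F\subseteq\Gamma$ and $\varepsilon>0$ such that every unitary representation $(\pi,H)$ of $\Gamma$ possessing a unit vector $\xi$ with $\|\pi(t)\xi-\xi\|<\varepsilon$ for all $t\in F$ has a non-zero $\Gamma$-invariant vector. **Theorem.** Let $\alpha$ be an action of a discrete group $\Gamma$ by $*$-automorphisms on a unital $C^*$-algebra $B$, let $B\rtimes_\alpha\Gamma$ be the full crossed product (the $C^*$-algebra generated by the universal covariant representation of $(B,\Gamma,\alpha)$), and regard $B$ as a subalgebra of it through the canonical map. If $\Gamma$ has property $(T)$, then the pair $(B\rtimes_\alpha\Gamma,B)$ is strongly co-rigid. Consequently, if $\Gamma$ has property $(T)$ and $B$ has strong property $(T)$, then $B\rtimes_\alpha\Gamma$ has strong property $(T)$, and so does the reduced crossed product $B\rtimes_{\alpha,r}\Gamma$ (the $C^*$-algebra of operators on $\ell^2(\Gamma,K)$ generated by $(\tilde\pi(b)\xi)(t)=\pi(\alpha_{t^{-1}}(b))\xi(t)$, $b\in B$, and $(\lambda_s\xi)(t)=\xi(s^{-1}t)$, $s\in\Gamma$, where $\pi$ is any faithful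 unital $*$-representation of $B$ on a Hilbert space $K$). -/

import Mathlib

open scoped ENNReal

universe u v w x

noncomputable section

namespace StrongT

/-! ### Property (T) for discrete groups -/

/-- Property (T) for the discrete group `Γ`: there are a non-empty finite set `F ⊆ Γ` and `ε > 0`
such that every unitary representation having an `(F, ε)`-invariant unit vector has a non-zero
invariant vector.

Here and below `w` is the universe of the Hilbert spaces on which representations and bimodules are
considered. Only the orbit of a single vector matters, so the property is the same for all `w` that
are at least the universe of the group or algebra; the theorem is stated for every `w`. -/
def GroupPropertyT (Γ : Type u) [Group Γ] : Prop :=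
  ∃ F : Finset Γ, F.Nonempty ∧ ∃ ε : ℝ, 0 < ε ∧
    ∀ (H : Type w) [NormedAddCommGroup H] [InnerProductSpace ℂ H] [CompleteSpace H]
      (π : Γ →* unitary (H →L[ℂ] H)),
      (∃ ξ : H, ‖ξ‖ = 1 ∧ ∀ t ∈ F, ‖(π t : H →L[ℂ] H) ξ - ξ‖ < ε) →
        ∃ η : H, η ≠ 0 ∧ ∀ t : Γ, (π t : H →L[ℂ] H) η = η

/-! ### Hilbert bimodules over unital C⋆-algebras -/

/-- A unital Hilbert bimodule structure over `A` on the Hilbert space `H`: commuting unital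
⋆-representations of `A` and of the opposite algebra of `A`. -/
structure HilbertBimodule (A : Type v) [CStarAlgebra A] (H : Type w) [NormedAddCommGroup H]
    [InnerProductSpace ℂ H] [CompleteSpace H] where
  /-- `a · ξ = left a ξ` -/
  left : A →⋆ₐ[ℂ] (H →L[ℂ] H)
  /-- `ξ · a = right (op a) ξ` -/
  right : Aᵐᵒᵖ →⋆ₐ[ℂ] (H →L[ℂ] H)
  comm : ∀ a b : A, Commute (left a) (right (MulOpposite.op b))

namespace HilbertBimodule

variable {A : Type v} [CStarAlgebra A] {H : Type w} [NormedAddCommGroup H]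
  [InnerProductSpace ℂ H] [CompleteSpace H]

/-- The operator `ξ ↦ a · ξ - ξ · a`. -/
def ad (M : HilbertBimodule A H) (a : A) : H →L[ℂ] H :=
  M.left a - M.right (MulOpposite.op a)

/-- The closed subspace `H^B` of central vectors for `B`. -/
def central (M : HilbertBimodule A H) (B : StarSubalgebra ℂ A) : Submodule ℂ H where
  carrier := {ξ | ∀ b ∈ B, M.left b ξ = M.right (MulOpposite.op b) ξ}
  add_mem' hξ hη b hb := by simp [hξ b hb, hη b hb]
  zero_mem' b _ := by simp
  smul_mem' c ξ hξ b hb := by simp [hξ b hb]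

theorem isClosed_central (M : HilbertBimodule A H) (B : StarSubalgebra ℂ A) :
    IsClosed (M.central B : Set H) := by
  have h : (M.central B : Set H) =
      ⋂ b ∈ B, {ξ | M.left b ξ = M.right (MulOpposite.op b) ξ} := by
    ext ξ
    simp [central]
  rw [h]
  exact isClosed_biInter fun b _ => isClosed_eq (M.left b).continuous (M.right _).continuous

instance (M : HilbertBimodule A H) (B : StarSubalgebra ℂ A) :
    (M.central B).HasOrthogonalProjection :=
  haveI : CompleteSpace (M.central B) := (M.isClosed_central B).completeSpace_coe
  inferInstance

/-- The `(Q, β)`-central unit vectors. -/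
def almostCentral (M : HilbertBimodule A H) (Q : Finset A) (β : ℝ) : Set H :=
  {ξ | ‖ξ‖ = 1 ∧ ∀ a ∈ Q, ‖M.ad a ξ‖ < β}

end HilbertBimodule

/-! ### Strong property (T) and strong co-rigidity -/

/-- Strong property (T) for the pair `(A, B)`. -/
def PairStrongPropertyT (A : Type v) [CStarAlgebra A] (B : StarSubalgebra ℂ A) : Prop :=
  ∀ γ : ℝ, 0 < γ → ∃ Q : Finset A, Q.Nonempty ∧ ∃ β : ℝ, 0 < β ∧
    ∀ (H : Type w) [NormedAddCommGroup H] [InnerProductSpace ℂ H] [CompleteSpace H]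
      (M : HilbertBimodule A H), ∀ ξ ∈ M.almostCentral Q β,
        ‖ξ - (M.central B).starProjection ξ‖ < γ

/-- Strong property (T) for the unital C⋆-algebra `A`. -/
def StrongPropertyT (A : Type v) [CStarAlgebra A] : Prop :=
  PairStrongPropertyT.{v, w} A ⊤

/-- Strong co-rigidity of the pair `(A, B)`. -/
def StronglyCoRigid (A : Type v) [CStarAlgebra A] (B : StarSubalgebra ℂ A) : Prop :=
  ∀ γ : ℝ, 0 < γ → ∃ Q : Finset A, Q.Nonempty ∧ ∃ δ : ℝ, 0 < δ ∧
    ∀ (H : Type w) [NormedAddCommGroup H] [InnerProductSpace ℂ H] [CompleteSpace H]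
      (M : HilbertBimodule A H), ∀ ξ ∈ M.almostCentral Q δ, ξ ∈ M.central B →
        ‖ξ - (M.central ⊤).starProjection ξ‖ < γ

/-! ### The full crossed product -/

section Full

variable {Γ : Type u} [Group Γ] {B : Type v} [CStarAlgebra B]

/-- A covariant representation of `(B, Γ, α)` on a non-zero Hilbert space: a unital
⋆-representation `π` of `B` and a unitary representation `U` of `Γ` on the same Hilbert space with
`U_t π(b) U_t* = π(α_t(b))`. Hilbert spaces of this universe suffice for all cyclic covariant
representations. -/
structure CovariantRep (α : Γ →* (B ≃⋆ₐ[ℂ] B)) where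
  H : Type (max u v)
  [normed : NormedAddCommGroup H]
  [inner : InnerProductSpace ℂ H]
  [complete : CompleteSpace H]
  [nontrivial : Nontrivial H]
  π : B →⋆ₐ[ℂ] (H →L[ℂ] H)
  U : Γ →* unitary (H →L[ℂ] H)
  covariant : ∀ (t : Γ) (b : B),
    (U t : H →L[ℂ] H) * π b * star (U t : H →L[ℂ] H) = π (α t b)

attribute [instance] CovariantRep.normed CovariantRep.inner CovariantRep.complete
  CovariantRep.nontrivial

variable (α : Γ →* (B ≃⋆ₐ[ℂ] B))

/-- The `ℓ^∞`-product of the algebras of all bounded operators on the spaces of all covariant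
representations, the target of the universal covariant representation. -/
abbrev CovariantProduct : Type _ :=
  lp (fun c : CovariantRep α => (c.H →L[ℂ] c.H)) ∞

instance : CStarAlgebra (CovariantProduct α) where

/-- The `B`-part of the universal covariant representation. -/
def universalCoeff : B →⋆ₐ[ℂ] CovariantProduct α where
  toFun b := ⟨fun c => c.π b, memℓp_infty ⟨‖b‖, by
    rintro _ ⟨c, rfl⟩
    exact NonUnitalStarAlgHom.norm_apply_le c.π b⟩⟩
  map_one' := by ext1; funext c; simp
  map_mul' a b := by ext1; funext c; simp
  map_zero' := by ext1; funext c; simp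
  map_add' a b := by ext1; funext c; simp; rfl
  commutes' r := by
    ext1; funext c
    exact AlgHomClass.commutes c.π r
  map_star' a := by
    ext1; funext c
    exact map_star c.π a

/-- The `Γ`-part of the universal covariant representation. -/
def universalGroup (t : Γ) : CovariantProduct α :=
  ⟨fun c => (c.U t : c.H →L[ℂ] c.H), memℓp_infty ⟨1, by
    rintro _ ⟨c, rfl⟩
    exact (CStarRing.norm_coe_unitary (c.U t)).le⟩⟩

/-- The full crossed product as a concrete C⋆-algebra: the closed ⋆-algebra generated by the
universal covariant representation. The closed linear span of the elements `π(b) U_t` is the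
completion of the finitely supported functions `Γ → B` in the supremum of the seminorms coming from
all covariant representations. -/
def fullCrossedProduct : StarSubalgebra ℂ (CovariantProduct α) :=
  (StarAlgebra.adjoin ℂ
    (Set.range (universalCoeff α) ∪ Set.range (universalGroup α))).topologicalClosure

instance : IsClosed (fullCrossedProduct α : Set (CovariantProduct α)) :=
  StarSubalgebra.isClosed_topologicalClosure _

/-- The full crossed product `B ⋊_α Γ`. -/
abbrev FullCrossedProduct : Type _ := fullCrossedProduct α

/-- The canonical map `B → B ⋊_α Γ`. -/
def canonicalMap : B →⋆ₐ[ℂ] FullCrossedProduct α :=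
  (universalCoeff α).codRestrict _ fun b =>
    StarSubalgebra.le_topologicalClosure _
      (StarAlgebra.subset_adjoin ℂ _ (Or.inl (Set.mem_range_self b)))

/-- The copy of `B` in `B ⋊_α Γ`. -/
def coefficientAlgebra : StarSubalgebra ℂ (FullCrossedProduct α) :=
  (canonicalMap α).range

end Full

/-! ### The reduced crossed product -/

section Reduced

variable {Γ : Type u} [Group Γ] {B : Type v} [CStarAlgebra B]
variable {K : Type x} [NormedAddCommGroup K] [InnerProductSpace ℂ K] [CompleteSpace K]

/-- The Hilbert space `ℓ²(Γ, K)`. -/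
abbrev EllTwo (Γ : Type u) (K : Type x) [NormedAddCommGroup K] : Type _ :=
  lp (fun _ : Γ => K) 2

theorem summable_sq {Γ : Type u} {K : Type x} [NormedAddCommGroup K] (f : EllTwo Γ K) :
    Summable fun t => ‖f t‖ ^ (2 : ℝ≥0∞).toReal :=
  (lp.memℓp f).summable (by norm_num)

/-- The operator `(π̃(b) ξ)(t) = π(α_{t⁻¹}(b)) ξ(t)` on `ℓ²(Γ, K)`. -/
def regularCoeff (α : Γ →* (B ≃⋆ₐ[ℂ] B)) (π : B →⋆ₐ[ℂ] (K →L[ℂ] K)) (b : B) :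
    EllTwo Γ K →L[ℂ] EllTwo Γ K :=
  have key : ∀ (ξ : EllTwo Γ K) (t : Γ),
      ‖π (α t⁻¹ b) (ξ t)‖ ^ (2 : ℝ≥0∞).toReal ≤
        ‖b‖ ^ (2 : ℝ≥0∞).toReal * ‖ξ t‖ ^ (2 : ℝ≥0∞).toReal := fun ξ t => by
    rw [← Real.mul_rpow (norm_nonneg _) (norm_nonneg _)]
    refine Real.rpow_le_rpow (norm_nonneg _) ?_ (by norm_num)
    refine ((π (α t⁻¹ b)).le_opNorm _).trans ?_
    gcongr
    exact (NonUnitalStarAlgHom.norm_apply_le π _).trans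
      (NonUnitalStarAlgHom.norm_apply_le (α t⁻¹ : B ≃⋆ₐ[ℂ] B) b)
  LinearMap.mkContinuous
    { toFun := fun ξ => ⟨fun t => π (α t⁻¹ b) (ξ t), memℓp_gen
        (Summable.of_nonneg_of_le (fun t => by positivity) (key ξ)
          ((summable_sq ξ).mul_left _))⟩
      map_add' := fun ξ η => by ext1; funext t; simp; rfl
      map_smul' := fun c ξ => by ext1; funext t; simp }
    ‖b‖ fun ξ => by
      refine lp.norm_le_of_tsum_le (by norm_num) (by positivity) ?_
      rw [Real.mul_rpow (norm_nonneg _) (norm_nonneg _),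
        lp.norm_rpow_eq_tsum (by norm_num) ξ, ← tsum_mul_left]
      exact Summable.tsum_le_tsum (key ξ)
        (Summable.of_nonneg_of_le (fun t => by positivity) (key ξ) ((summable_sq ξ).mul_left _))
        ((summable_sq ξ).mul_left _)

/-- The operator `(λ_s ξ)(t) = ξ(s⁻¹ t)` on `ℓ²(Γ, K)`. -/
def regularGroup (s : Γ) : EllTwo Γ K →L[ℂ] EllTwo Γ K :=
  LinearMap.mkContinuous
    { toFun := fun ξ => ⟨fun t => ξ (s⁻¹ * t), memℓp_gen
        ((Equiv.mulLeft s⁻¹).summable_iff.mpr (summable_sq ξ))⟩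
      map_add' := fun ξ η => by ext1; funext t; simp; rfl
      map_smul' := fun c ξ => by ext1; funext t; simp }
    1 fun ξ => by
      refine lp.norm_le_of_tsum_le (by norm_num) (by positivity) ?_
      rw [one_mul, lp.norm_rpow_eq_tsum (by norm_num) ξ]
      exact ((Equiv.mulLeft s⁻¹).tsum_eq fun t => ‖ξ t‖ ^ (2 : ℝ≥0∞).toReal).le

/-- The C⋆-algebra of operators on `ℓ²(Γ, K)` generated by the regular covariant representation
induced from `π`. For faithful `π` it is the reduced crossed product. -/
def reducedCrossedProduct (α : Γ →* (B ≃⋆ₐ[ℂ] B)) (π : B →⋆ₐ[ℂ] (K →L[ℂ] K)) :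
    StarSubalgebra ℂ (EllTwo Γ K →L[ℂ] EllTwo Γ K) :=
  (StarAlgebra.adjoin ℂ
    (Set.range (regularCoeff α π) ∪ Set.range (regularGroup (K := K)))).topologicalClosure

instance (α : Γ →* (B ≃⋆ₐ[ℂ] B)) (π : B →⋆ₐ[ℂ] (K →L[ℂ] K)) :
    IsClosed (reducedCrossedProduct α π : Set (EllTwo Γ K →L[ℂ] EllTwo Γ K)) :=
  StarSubalgebra.isClosed_topologicalClosure _

/-- The reduced crossed product `B ⋊_{α,r} Γ` formed with the (faithful) representation `π`. -/
abbrev ReducedCrossedProduct (α : Γ →* (B ≃⋆ₐ[ℂ] B)) (π : B →⋆ₐ[ℂ] (K →L[ℂ] K)) : Type _ :=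
  reducedCrossedProduct α π

end Reduced

end StrongT

end

noncomputable section

namespace StrongT

/-! ### Kazhdan pairs -/

/-! Let `A` be generated by a copy of `B` and unitaries `u_t` implementing the action. On a bimodule
`H` over `A`, conjugation `ξ ↦ u_t · ξ · u_t*` is a unitary representation of `Γ` which moves `ξ` by
exactly `‖u_t · ξ - ξ · u_t‖`. Covariance makes `H^B` invariant, and its fixed vectors are exactly
`H^A`, because the elements commuting with a vector together with their adjoints form a closed
⋆-subalgebra.

Thus `H^B ⊖ H^A` carries no invariant vectors, and a Kazhdan pair `(F, ε)` gives for each `ζ ∈ H^B`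
some `t ∈ F` with `ε * dist(ζ, H^A) ≤ ‖u_t · ζ - ζ · u_t‖` (`exists_le_norm_ad`). This is strong
co-rigidity. If `B` has strong property (T), an almost central vector is first projected to `H^B`,
then to `H^A`. Only covariance and generation enter, so the full and reduced crossed products are
treated alike. -/

/-- `(F, ε)` is a Kazhdan pair for `Γ`: every unitary representation with an `(F, ε)`-invariant
unit vector has a non-zero invariant vector. -/
def IsKazhdanPair (Γ : Type u) [Group Γ] (F : Finset Γ) (ε : ℝ) : Prop :=
  ∀ (H : Type w) [NormedAddCommGroup H] [InnerProductSpace ℂ H] [CompleteSpace H]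
    (π : Γ →* unitary (H →L[ℂ] H)),
    (∃ ξ : H, ‖ξ‖ = 1 ∧ ∀ t ∈ F, ‖(π t : H →L[ℂ] H) ξ - ξ‖ < ε) →
      ∃ η : H, η ≠ 0 ∧ ∀ t : Γ, (π t : H →L[ℂ] H) η = η

section Rep

variable {Γ : Type u} [Group Γ] {H : Type w} [NormedAddCommGroup H] [InnerProductSpace ℂ H]
  [CompleteSpace H]

theorem inner_rep_left (π : Γ →* unitary (H →L[ℂ] H)) (t : Γ) (x y : H) :
    inner ℂ ((π t : H →L[ℂ] H) x) y = inner ℂ x ((π t⁻¹ : H →L[ℂ] H) y) := by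
  have h : (π t : H →L[ℂ] H) ((π t⁻¹ : H →L[ℂ] H) y) = y := by
    have h₁ : (π t : H →L[ℂ] H) * (π t⁻¹ : H →L[ℂ] H) = 1 := by
      rw [← Submonoid.coe_mul, ← map_mul, mul_inv_cancel, map_one, Submonoid.coe_one]
    exact congrArg (fun T : H →L[ℂ] H => T y) h₁
  conv_lhs => rw [← h]
  exact ContinuousLinearMap.inner_map_map_of_mem_unitary (π t).2 _ _

/-- The restriction of a unitary representation to a closed invariant subspace. -/
def restrictRep (π : Γ →* unitary (H →L[ℂ] H)) (K : Submodule ℂ H) [CompleteSpace K]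
    (hK : ∀ t, ∀ x ∈ K, (π t : H →L[ℂ] H) x ∈ K) : Γ →* unitary (K →L[ℂ] K) :=
  have mul (s t : Γ) : (π (s * t) : H →L[ℂ] H).restrict (hK (s * t)) =
      (π s : H →L[ℂ] H).restrict (hK s) * (π t : H →L[ℂ] H).restrict (hK t) := by
    ext x
    simp
  have one : (π 1 : H →L[ℂ] H).restrict (hK 1) = 1 := by
    ext x
    simp
  have star_eq (t : Γ) : star ((π t : H →L[ℂ] H).restrict (hK t)) =
      (π t⁻¹ : H →L[ℂ] H).restrict (hK t⁻¹) := by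
    rw [ContinuousLinearMap.star_eq_adjoint]
    refine ((ContinuousLinearMap.eq_adjoint_iff _ _).2 fun x y => ?_).symm
    have := inner_rep_left π t⁻¹ (x : H) (y : H)
    rw [inv_inv] at this
    simpa using this
  { toFun := fun t => ⟨(π t : H →L[ℂ] H).restrict (hK t), Unitary.mem_iff.2
      ⟨by simp only [star_eq, ← mul, inv_mul_cancel, one],
       by simp only [star_eq, ← mul, mul_inv_cancel, one]⟩⟩
    map_one' := Subtype.ext one
    map_mul' := fun s t => Subtype.ext (mul s t) }

/-- A vector of a closed invariant subspace without non-zero invariant vectors is displaced by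
some element of the Kazhdan set. -/
theorem IsKazhdanPair.exists_le_norm_sub {F : Finset Γ} {ε : ℝ}
    (h : IsKazhdanPair.{u, w} Γ F ε) (hF : F.Nonempty)
    (π : Γ →* unitary (H →L[ℂ] H)) (K : Submodule ℂ H) [CompleteSpace K]
    (hK : ∀ t, ∀ x ∈ K, (π t : H →L[ℂ] H) x ∈ K)
    (hfix : ∀ x ∈ K, (∀ t, (π t : H →L[ℂ] H) x = x) → x = 0) {η : H} (hη : η ∈ K) :
    ∃ t ∈ F, ε * ‖η‖ ≤ ‖(π t : H →L[ℂ] H) η - η‖ := by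
  by_contra! hlt
  obtain ⟨t₀, ht₀⟩ := hF
  -- For `η = 0` the negated bound would read `0 < 0` at `t₀`; this is where non-emptiness of `F`
  -- matters.
  have hη0 : η ≠ 0 := by
    rintro rfl
    simpa using hlt t₀ ht₀
  have hpos : 0 < ‖η‖ := norm_pos_iff.2 hη0
  obtain ⟨ζ, hζ0, hζ⟩ := h K (restrictRep π K hK)
    ⟨((‖η‖⁻¹ : ℝ) : ℂ) • ⟨η, hη⟩, by
      rw [norm_smul, Complex.norm_real, norm_inv, norm_norm, Submodule.coe_norm]
      exact inv_mul_cancel₀ hpos.ne', fun t ht => by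
      rw [map_smul, ← smul_sub, norm_smul, Complex.norm_real, norm_inv, norm_norm,
        inv_mul_lt_iff₀ hpos, mul_comm]
      exact hlt t ht⟩
  refine hζ0 (Subtype.ext (hfix ζ ζ.2 fun t => ?_))
  exact congrArg Subtype.val (hζ t)

/-- Quantitative form of property (T): if `L` consists of the invariant vectors of the closed
invariant subspace `K`, then vectors of `K` which are almost fixed by the Kazhdan set are close
to `L`. -/
theorem IsKazhdanPair.exists_le_norm_sub_starProjection {F : Finset Γ} {ε : ℝ}
    (h : IsKazhdanPair.{u, w} Γ F ε) (hF : F.Nonempty)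
    (π : Γ →* unitary (H →L[ℂ] H)) (K L : Submodule ℂ H) [L.HasOrthogonalProjection]
    (hcl : IsClosed (K : Set H)) (hK : ∀ t, ∀ x ∈ K, (π t : H →L[ℂ] H) x ∈ K)
    (hL : ∀ x, x ∈ L ↔ x ∈ K ∧ ∀ t, (π t : H →L[ℂ] H) x = x) {ζ : H} (hζ : ζ ∈ K) :
    ∃ t ∈ F, ε * ‖ζ - L.starProjection ζ‖ ≤ ‖(π t : H →L[ℂ] H) ζ - ζ‖ := by
  have hcl' : IsClosed ((K ⊓ Lᗮ : Submodule ℂ H) : Set H) :=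
    hcl.inter L.isClosed_orthogonal
  have : CompleteSpace (K ⊓ Lᗮ : Submodule ℂ H) := hcl'.completeSpace_coe
  have hP := (hL _).1 (L.starProjection_apply_mem ζ)
  -- On `K ⊓ Lᗮ` an invariant vector lies in `L` and is orthogonal to itself, hence zero. Invariance
  -- of `Lᗮ` follows from unitarity, since `π t` fixes `L` pointwise.
  obtain ⟨t, ht, hle⟩ := h.exists_le_norm_sub hF π (K ⊓ Lᗮ)
    (fun t x hx => ⟨hK t x hx.1, fun y hy => by
      rw [← ((hL y).1 hy).2 t, ContinuousLinearMap.inner_map_map_of_mem_unitary (π t).2]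
      exact hx.2 y hy⟩)
    (fun x hx hfix => by
      have hxL : x ∈ L := (hL x).2 ⟨hx.1, hfix⟩
      exact inner_self_eq_zero.1 (hx.2 x hxL))
    (η := ζ - L.starProjection ζ)
    ⟨K.sub_mem hζ hP.1, L.sub_starProjection_mem_orthogonal ζ⟩
  refine ⟨t, ht, hle.trans_eq ?_⟩
  -- The projection of `ζ` is fixed by `π t`, so subtracting it leaves the displacement unchanged.
  rw [map_sub, hP.2 t, sub_sub_sub_cancel_right]

end Rep

theorem norm_sub_starProjection_le {H : Type w} [NormedAddCommGroup H] [InnerProductSpace ℂ H]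
    (L : Submodule ℂ H) [L.HasOrthogonalProjection] (ξ : H) {η : H} (hη : η ∈ L) :
    ‖ξ - L.starProjection ξ‖ ≤ ‖ξ - η‖ := by
  rw [L.starProjection_minimal]
  exact ciInf_le ⟨0, by rintro _ ⟨y, rfl⟩; exact norm_nonneg _⟩ (⟨η, hη⟩ : L)

/-! ### Bimodules over algebras generated by a covariant pair -/

namespace HilbertBimodule

variable {A : Type v} [CStarAlgebra A] {H : Type w} [NormedAddCommGroup H]
  [InnerProductSpace ℂ H] [CompleteSpace H]

theorem ad_apply (M : HilbertBimodule A H) (a : A) (ξ : H) :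
    M.ad a ξ = M.left a ξ - M.right (MulOpposite.op a) ξ :=
  rfl

theorem left_right (M : HilbertBimodule A H) (a b : A) (ξ : H) :
    M.left a (M.right (MulOpposite.op b) ξ) = M.right (MulOpposite.op b) (M.left a ξ) :=
  congrArg (fun T : H →L[ℂ] H => T ξ) (M.comm a b).eq

theorem left_mul (M : HilbertBimodule A H) (a b : A) (ξ : H) :
    M.left (a * b) ξ = M.left a (M.left b ξ) := by
  rw [map_mul]; rfl

theorem right_mul (M : HilbertBimodule A H) (a b : A) (ξ : H) :
    M.right (MulOpposite.op (a * b)) ξ =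
      M.right (MulOpposite.op b) (M.right (MulOpposite.op a) ξ) := by
  rw [MulOpposite.op_mul, map_mul]; rfl

/-- The elements of `A` which, together with their adjoints, commute with a given vector. -/
def commutant (M : HilbertBimodule A H) (ξ : H) : StarSubalgebra ℂ A where
  carrier := {a | M.left a ξ = M.right (MulOpposite.op a) ξ ∧
    M.left (star a) ξ = M.right (MulOpposite.op (star a)) ξ}
  mul_mem' {a b} ha hb := by
    simp only [Set.mem_ofPred_eq] at ha hb ⊢
    constructor
    · rw [left_mul, right_mul, hb.1, left_right, ha.1]
    · rw [star_mul, left_mul, right_mul, ha.2, left_right, hb.2]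
  add_mem' {a b} ha hb := by
    simp only [Set.mem_ofPred_eq] at ha hb ⊢
    simp [ha.1, ha.2, hb.1, hb.2]
  algebraMap_mem' r := by
    have key (r : ℂ) : M.left (algebraMap ℂ A r) ξ =
        M.right (MulOpposite.op (algebraMap ℂ A r)) ξ := by
      rw [← MulOpposite.algebraMap_apply, AlgHomClass.commutes, AlgHomClass.commutes]
    refine ⟨key r, ?_⟩
    rw [← algebraMap_star_comm]
    exact key _
  star_mem' {a} ha := ⟨ha.2, by simpa only [star_star] using ha.1⟩

theorem continuous_left (M : HilbertBimodule A H) : Continuous M.left :=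
  AddMonoidHomClass.continuous_of_bound M.left 1 fun a => by
    rw [one_mul]
    exact NonUnitalStarAlgHom.norm_apply_le M.left a

theorem continuous_right (M : HilbertBimodule A H) : Continuous M.right :=
  AddMonoidHomClass.continuous_of_bound M.right 1 fun a => by
    rw [one_mul]
    exact NonUnitalStarAlgHom.norm_apply_le M.right a

theorem isClosed_commutant (M : HilbertBimodule A H) (ξ : H) :
    IsClosed (M.commutant ξ : Set A) := by
  have hl : Continuous fun a : A => M.left a ξ := M.continuous_left.clm_apply continuous_const
  have hr : Continuous fun a : A => M.right (MulOpposite.op a) ξ :=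
    (M.continuous_right.comp MulOpposite.continuous_op).clm_apply continuous_const
  exact (isClosed_eq hl hr).inter
    (isClosed_eq (hl.comp continuous_star) (hr.comp continuous_star))

variable {B : Type x} [CStarAlgebra B]

/-- Restriction of scalars along a unital ⋆-homomorphism. -/
def comap (M : HilbertBimodule A H) (ι : B →⋆ₐ[ℂ] A) : HilbertBimodule B H where
  left := M.left.comp ι
  right :=
    { toFun := fun b => M.right (MulOpposite.op (ι b.unop))
      map_one' := by simp
      map_mul' := fun a b => by simp
      map_zero' := by simp
      map_add' := fun a b => by simp
      commutes' := fun r => by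
        rw [MulOpposite.algebraMap_apply, MulOpposite.unop_op, AlgHomClass.commutes,
          ← MulOpposite.algebraMap_apply, AlgHomClass.commutes]
      map_star' := fun b => by
        rw [MulOpposite.unop_star, map_star, MulOpposite.op_star, map_star] }
  comm a b := M.comm (ι a) (ι b)

theorem central_comap_top (M : HilbertBimodule A H) (ι : B →⋆ₐ[ℂ] A) :
    (M.comap ι).central ⊤ = M.central ι.range := by
  ext ξ
  constructor
  · rintro h _ ⟨b, rfl⟩
    exact h b trivial
  · intro h b _
    exact h (ι b) ⟨b, rfl⟩

variable {Γ : Type u} [Group Γ]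

/-- The unitary representation `ξ ↦ u_t · ξ · u_t*`. -/
def conjRep (M : HilbertBimodule A H) (U : Γ →* unitary A) : Γ →* unitary (H →L[ℂ] H) where
  toFun t := ⟨M.left (U t) * M.right (MulOpposite.op (star (U t : A))), by
    refine mul_mem (Unitary.map_mem M.left (U t).2) (Unitary.map_mem M.right ?_)
    rw [Unitary.mem_iff]
    simp only [← MulOpposite.op_star, ← MulOpposite.op_mul]
    simp⟩
  map_one' := by ext; simp
  map_mul' s t := by
    ext ξ
    change M.left _ (M.right _ ξ) = M.left _ (M.right _ (M.left _ (M.right _ ξ)))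
    rw [map_mul, Submonoid.coe_mul, star_mul, left_mul, right_mul, left_right]

theorem conjRep_apply (M : HilbertBimodule A H) (U : Γ →* unitary A) (t : Γ) (ξ : H) :
    (M.conjRep U t : H →L[ℂ] H) ξ =
      M.left (U t) (M.right (MulOpposite.op (star (U t : A))) ξ) :=
  rfl

theorem right_conjRep (M : HilbertBimodule A H) (U : Γ →* unitary A) (t : Γ) (ξ : H) :
    M.right (MulOpposite.op (U t : A)) ((M.conjRep U t : H →L[ℂ] H) ξ) = M.left (U t) ξ := by
  rw [conjRep_apply, ← left_right, ← right_mul]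
  simp

theorem norm_right_unitary (M : HilbertBimodule A H) (U : unitary A) (ξ : H) :
    ‖M.right (MulOpposite.op (U : A)) ξ‖ = ‖ξ‖ := by
  refine ContinuousLinearMap.norm_map_of_mem_unitary (Unitary.map_mem M.right ?_) ξ
  rw [Unitary.mem_iff]
  simp only [← MulOpposite.op_star, ← MulOpposite.op_mul]
  simp

theorem norm_left_unitary (M : HilbertBimodule A H) (U : unitary A) (ξ : H) :
    ‖M.left (U : A) ξ‖ = ‖ξ‖ :=
  ContinuousLinearMap.norm_map_of_mem_unitary (Unitary.map_mem M.left U.2) ξ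

/-- Right multiplication by `u_t` is isometric and turns `u_t · ξ · u_t* - ξ` into `u_t · ξ - ξ ·
u_t`. -/
theorem norm_conjRep_sub (M : HilbertBimodule A H) (U : Γ →* unitary A) (t : Γ) (ξ : H) :
    ‖(M.conjRep U t : H →L[ℂ] H) ξ - ξ‖ = ‖M.ad (U t) ξ‖ := by
  rw [← M.norm_right_unitary (U t), map_sub, right_conjRep, ad_apply]

theorem norm_ad_unitary_le (M : HilbertBimodule A H) (U : unitary A) (ξ : H) :
    ‖M.ad (U : A) ξ‖ ≤ 2 * ‖ξ‖ := by
  rw [ad_apply]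
  refine (norm_sub_le _ _).trans_eq ?_
  rw [norm_left_unitary, norm_right_unitary, two_mul]

theorem left_eq_right_of_conjRep_eq (M : HilbertBimodule A H) (U : Γ →* unitary A) {t : Γ} {ξ : H}
    (h : (M.conjRep U t : H →L[ℂ] H) ξ = ξ) :
    M.left (U t) ξ = M.right (MulOpposite.op (U t : A)) ξ := by
  rw [← right_conjRep, h]

end HilbertBimodule

/-- `A` is generated as a C⋆-algebra by the images of the covariant pair `(ι, U)` of
`(B, Γ, α)`. -/
structure IsGeneratingCovariantPair {Γ : Type u} [Group Γ] {B : Type x} [CStarAlgebra B]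
    {A : Type v} [CStarAlgebra A] (α : Γ →* (B ≃⋆ₐ[ℂ] B)) (ι : B →⋆ₐ[ℂ] A)
    (U : Γ →* unitary A) : Prop where
  covariant : ∀ t b, (U t : A) * ι b * star (U t : A) = ι (α t b)
  generate : ∀ S : StarSubalgebra ℂ A, IsClosed (S : Set A) → (∀ b, ι b ∈ S) →
    (∀ t, (U t : A) ∈ S) → S = ⊤

namespace IsGeneratingCovariantPair

variable {Γ : Type u} [Group Γ] {B : Type x} [CStarAlgebra B] {A : Type v} [CStarAlgebra A]
  {α : Γ →* (B ≃⋆ₐ[ℂ] B)} {ι : B →⋆ₐ[ℂ] A} {U : Γ →* unitary A}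
  {H : Type w} [NormedAddCommGroup H] [InnerProductSpace ℂ H] [CompleteSpace H]

theorem mul_coeff (h : IsGeneratingCovariantPair α ι U) (t : Γ) (b : B) :
    (U t : A) * ι b = ι (α t b) * U t := by
  rw [← h.covariant, mul_assoc, Unitary.coe_star_mul_self, mul_one]

theorem coeff_mul_star (h : IsGeneratingCovariantPair α ι U) (t : Γ) (b : B) :
    ι b * star (U t : A) = star (U t : A) * ι (α t b) := by
  rw [← h.covariant, ← mul_assoc, ← mul_assoc, Unitary.coe_star_mul_self, one_mul]

/-- Moving `α_t(b)` past `u_t` turns it into `b`, which passes through the central vector `ξ` and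
becomes `α_t(b)` again on crossing `u_t*`. -/
theorem conjRep_mem_central (h : IsGeneratingCovariantPair α ι U) (M : HilbertBimodule A H)
    (t : Γ) {ξ : H} (hξ : ξ ∈ M.central ι.range) :
    (M.conjRep U t : H →L[ℂ] H) ξ ∈ M.central ι.range := by
  rintro _ ⟨b, rfl⟩
  -- Every coefficient has the form `α_t(b)`, the form to which covariance applies.
  obtain ⟨b, rfl⟩ := (α t).surjective b
  change M.left (ι (α t b)) _ = M.right (MulOpposite.op (ι (α t b))) _
  rw [HilbertBimodule.conjRep_apply, ← M.left_mul, ← h.mul_coeff, M.left_mul, M.left_right,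
    hξ (ι b) ⟨b, rfl⟩, ← M.right_mul, h.coeff_mul_star, M.right_mul, M.left_right]

theorem mem_central_top_iff (h : IsGeneratingCovariantPair α ι U) (M : HilbertBimodule A H)
    (ξ : H) : ξ ∈ M.central ⊤ ↔
      ξ ∈ M.central ι.range ∧ ∀ t, (M.conjRep U t : H →L[ℂ] H) ξ = ξ := by
  constructor
  · refine fun hξ => ⟨fun b _ => hξ b trivial, fun t => ?_⟩
    rw [← sub_eq_zero, ← norm_eq_zero, M.norm_conjRep_sub, M.ad_apply, hξ _ trivial, sub_self,
      norm_zero]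
  · rintro ⟨hB, hU⟩ a -
    have htop := h.generate (M.commutant ξ) (M.isClosed_commutant ξ)
      (fun b => ⟨hB _ ⟨b, rfl⟩, by
        rw [← map_star]
        exact hB _ ⟨star b, rfl⟩⟩)
      (fun t => ⟨M.left_eq_right_of_conjRep_eq U (hU t), by
        -- The commutant also requires the adjoint of `u_t`, which is the unitary at `t⁻¹`.
        have hinv := M.left_eq_right_of_conjRep_eq U (hU t⁻¹)
        rwa [map_inv, ← Unitary.star_eq_inv, Unitary.coe_star] at hinv⟩)
    have ha : a ∈ M.commutant ξ := htop ▸ trivial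
    exact ha.1

/-- `B`-central vectors almost commuting with the unitaries of the Kazhdan set are close to
central vectors. -/
theorem exists_le_norm_ad (h : IsGeneratingCovariantPair α ι U) {F : Finset Γ} {ε : ℝ}
    (hT : IsKazhdanPair.{u, w} Γ F ε) (hF : F.Nonempty) (M : HilbertBimodule A H) {ζ : H}
    (hζ : ζ ∈ M.central ι.range) :
    ∃ t ∈ F, ε * ‖ζ - (M.central ⊤).starProjection ζ‖ ≤ ‖M.ad (U t) ζ‖ := by
  obtain ⟨t, ht, hle⟩ := hT.exists_le_norm_sub_starProjection hF (M.conjRep U)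
    (M.central ι.range) (M.central ⊤) (M.isClosed_central _)
    (fun t x hx => h.conjRep_mem_central M t hx) (h.mem_central_top_iff M) hζ
  exact ⟨t, ht, hle.trans_eq (M.norm_conjRep_sub U t ζ)⟩

theorem stronglyCoRigid (h : IsGeneratingCovariantPair α ι U) (hΓ : GroupPropertyT.{u, w} Γ) :
    StronglyCoRigid.{v, w} A ι.range := by
  classical
  obtain ⟨F, hF, ε, hε, hT⟩ := hΓ
  refine fun γ hγ => ⟨F.image fun t => (U t : A), hF.image _, ε * γ, by positivity, ?_⟩
  intro H _ _ _ M ξ hξ hB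
  obtain ⟨t, ht, hle⟩ := h.exists_le_norm_ad hT hF M hB
  exact lt_of_mul_lt_mul_left
    (hle.trans_lt (hξ.2 _ (Finset.mem_image_of_mem (fun t => (U t : A)) ht))) hε.le

theorem strongPropertyT (h : IsGeneratingCovariantPair α ι U) (hΓ : GroupPropertyT.{u, w} Γ)
    (hB : StrongPropertyT.{x, w} B) : StrongPropertyT.{v, w} A := by
  classical
  obtain ⟨F, hF, ε, hε, hT⟩ := hΓ
  intro γ hγ
  -- The bound `γ / 2` serves the final triangle inequality. The bound `ε * γ / 8` limits the error
  -- in replacing `ξ` by its projection `ζ` to `H^B`.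
  obtain ⟨Q, hQ, β, hβ, hQβ⟩ := hB (min (γ / 2) (ε * γ / 8)) (by positivity)
  refine ⟨Q.image ι ∪ F.image fun t => (U t : A), (hQ.image _).inl, min β (ε * γ / 8),
    by positivity, ?_⟩
  intro H _ _ _ M ξ hξ
  have hclose := hQβ H (M.comap ι) ξ ⟨hξ.1, fun b hb => (hξ.2 (ι b) (Finset.mem_union_left _
    (Finset.mem_image_of_mem _ hb))).trans_le (min_le_left _ _)⟩
  simp only [M.central_comap_top] at hclose
  set ζ := (M.central ι.range).starProjection ξ with hζdef
  obtain ⟨hc₁, hc₂⟩ := lt_min_iff.1 hclose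
  obtain ⟨t, ht, hle⟩ := h.exists_le_norm_ad hT hF M
    ((M.central ι.range).starProjection_apply_mem ξ)
  rw [← hζdef] at hle
  have hξt : ‖M.ad (U t) ξ‖ < ε * γ / 8 := (hξ.2 _ (Finset.mem_union_right _
    (Finset.mem_image_of_mem (fun t => (U t : A)) ht))).trans_le (min_le_right _ _)
  have hadζ : ‖M.ad (U t) ζ‖ ≤ ‖M.ad (U t) ξ‖ + 2 * ‖ξ - ζ‖ := by
    have h₁ : M.ad (U t) ζ = M.ad (U t) ξ - M.ad (U t) (ξ - ζ) := by rw [map_sub]; abel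
    rw [h₁]
    exact (norm_sub_le _ _).trans (by gcongr; exact M.norm_ad_unitary_le (U t) _)
  have hζ : ‖ζ - (M.central ⊤).starProjection ζ‖ < γ / 2 := by
    refine lt_of_mul_lt_mul_left ?_ hε.le
    -- The displacement of `ζ` is below `ε * γ / 8 + 2 * (ε * γ / 8)`, which is less than `ε * (γ /
    -- 2)`.
    nlinarith
  calc ‖ξ - (M.central ⊤).starProjection ξ‖
      ≤ ‖ξ - (M.central ⊤).starProjection ζ‖ :=
        norm_sub_starProjection_le _ _ ((M.central ⊤).starProjection_apply_mem ζ)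
    _ ≤ ‖ξ - ζ‖ + ‖ζ - (M.central ⊤).starProjection ζ‖ := norm_sub_le_norm_sub_add_norm_sub _ _ _
    _ < γ := by linarith

end IsGeneratingCovariantPair

/-- A covariant pair in a closed ⋆-subalgebra `C` generates `C` if `C` lies in the closed
⋆-algebra generated by the pair in the ambient algebra. -/
theorem IsGeneratingCovariantPair.of_le_topologicalClosure {Γ : Type u} [Group Γ] {B : Type x}
    [CStarAlgebra B] {D : Type v} [CStarAlgebra D] {C : StarSubalgebra ℂ D}
    [hcl : IsClosed (C : Set D)] {α : Γ →* (B ≃⋆ₐ[ℂ] B)} {ι : B →⋆ₐ[ℂ] C} {U : Γ →* unitary C}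
    (hcov : ∀ t b, (U t : C) * ι b * star (U t : C) = ι (α t b))
    (hC : C ≤ (StarAlgebra.adjoin ℂ ((Set.range fun b => (ι b : D)) ∪
      Set.range fun t => ((U t : C) : D))).topologicalClosure) :
    IsGeneratingCovariantPair α ι U where
  covariant := hcov
  generate S hS hι hU := by
    -- As `C` is closed in `D`, a closed subalgebra of `C` stays closed in `D`, so it contains the
    -- closure taken there.
    have hmap : IsClosed (S.map C.subtype : Set D) :=
      hcl.isClosedEmbedding_subtypeVal.isClosedMap _ hS
    have hle := hC.trans (StarSubalgebra.topologicalClosure_minimal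
      (t := S.map C.subtype) (StarAlgebra.adjoin_le (by
        rintro _ (⟨b, rfl⟩ | ⟨t, rfl⟩)
        · exact ⟨_, hι b, rfl⟩
        · exact ⟨_, hU t, rfl⟩)) hmap)
    refine eq_top_iff.2 fun c _ => ?_
    obtain ⟨c', hc', h⟩ := hle c.2
    rwa [← Subtype.ext h]

/-- A family of unitaries of `D` multiplicative in `t` and contained in `C`, as a homomorphism into
the unitary group of `C`. -/
def unitaryHom {Γ : Type u} [Group Γ] {D : Type v} [CStarAlgebra D] (C : StarSubalgebra ℂ D)
    (g : Γ → D) (one : g 1 = 1) (mul : ∀ s t, g (s * t) = g s * g t)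
    (star_eq : ∀ t, star (g t) = g t⁻¹) (mem : ∀ t, g t ∈ C) : Γ →* unitary C where
  toFun t := ⟨⟨g t, mem t⟩, Unitary.mem_iff.2
    ⟨Subtype.ext (by
      change star (g t) * g t = 1
      rw [star_eq, ← mul, inv_mul_cancel, one]),
    Subtype.ext (by
      change g t * star (g t) = 1
      rw [star_eq, ← mul, mul_inv_cancel, one])⟩⟩
  map_one' := Subtype.ext (Subtype.ext one)
  map_mul' s t := Subtype.ext (Subtype.ext (mul s t))

/-! ### The full crossed product -/

section Full

variable {Γ : Type u} [Group Γ] {B : Type v} [CStarAlgebra B] (α : Γ →* (B ≃⋆ₐ[ℂ] B))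

/-- The canonical homomorphism from `Γ` to the unitary group of `B ⋊_α Γ`. -/
def canonicalUnitary : Γ →* unitary (FullCrossedProduct α) :=
  unitaryHom (fullCrossedProduct α) (universalGroup α)
    (by ext1; funext c; simp [universalGroup])
    (fun s t => by ext1; funext c; simp [universalGroup])
    (fun t => by
      ext1; funext c
      change star (c.U t : c.H →L[ℂ] c.H) = (c.U t⁻¹ : c.H →L[ℂ] c.H)
      rw [map_inv, ← Unitary.star_eq_inv, Unitary.coe_star])
    (fun t => StarSubalgebra.le_topologicalClosure _
      (StarAlgebra.subset_adjoin ℂ _ (Or.inr (Set.mem_range_self t))))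

theorem isGeneratingCovariantPair_full :
    IsGeneratingCovariantPair α (canonicalMap α) (canonicalUnitary α) :=
  .of_le_topologicalClosure
    (fun t b => by
      apply Subtype.ext
      apply Subtype.ext
      funext c
      exact c.covariant t b)
    le_rfl

end Full

/-! ### The reduced crossed product -/

section Reduced

variable {Γ : Type u} [Group Γ] {B : Type v} [CStarAlgebra B]
variable {K : Type x} [NormedAddCommGroup K] [InnerProductSpace ℂ K]

theorem regularGroup_apply (s : Γ) (ξ : EllTwo Γ K) (t : Γ) :
    regularGroup s ξ t = ξ (s⁻¹ * t) :=
  rfl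

theorem regularGroup_one : regularGroup (K := K) (1 : Γ) = 1 := by
  ext ξ t
  simp [regularGroup_apply]

theorem regularGroup_mul (s t : Γ) :
    regularGroup (K := K) (s * t) = regularGroup s * regularGroup t := by
  ext ξ r
  simp [regularGroup_apply, mul_assoc]

variable [CompleteSpace K]

theorem regularCoeff_apply (α : Γ →* (B ≃⋆ₐ[ℂ] B)) (π : B →⋆ₐ[ℂ] (K →L[ℂ] K)) (b : B)
    (ξ : EllTwo Γ K) (t : Γ) : regularCoeff α π b ξ t = π (α t⁻¹ b) (ξ t) :=
  rfl

/-- The regular representation `π̃` as a unital ⋆-homomorphism. -/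
def regularCoeffHom (α : Γ →* (B ≃⋆ₐ[ℂ] B)) (π : B →⋆ₐ[ℂ] (K →L[ℂ] K)) :
    B →⋆ₐ[ℂ] (EllTwo Γ K →L[ℂ] EllTwo Γ K) where
  toFun := regularCoeff α π
  map_one' := by ext ξ t; simp [regularCoeff_apply]
  map_mul' a b := by ext ξ t; simp [regularCoeff_apply]
  map_zero' := by ext ξ t; simp [regularCoeff_apply]
  map_add' a b := by ext ξ t; simp [regularCoeff_apply]
  commutes' r := by
    ext ξ t
    rw [regularCoeff_apply, AlgHomClass.commutes, AlgHomClass.commutes]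
    rfl
  map_star' b := by
    rw [ContinuousLinearMap.star_eq_adjoint]
    refine (ContinuousLinearMap.eq_adjoint_iff _ _).2 fun ξ η => ?_
    rw [lp.inner_eq_tsum, lp.inner_eq_tsum]
    refine tsum_congr fun t => ?_
    rw [regularCoeff_apply, regularCoeff_apply, map_star, map_star,
      ContinuousLinearMap.star_eq_adjoint, ContinuousLinearMap.adjoint_inner_left]

theorem star_regularGroup (s : Γ) :
    star (regularGroup (K := K) s) = regularGroup s⁻¹ := by
  rw [ContinuousLinearMap.star_eq_adjoint]
  refine ((ContinuousLinearMap.eq_adjoint_iff _ _).2 fun ξ η => ?_).symm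
  rw [lp.inner_eq_tsum, lp.inner_eq_tsum, ← (Equiv.mulLeft s⁻¹).tsum_eq]
  refine tsum_congr fun t => ?_
  simp [regularGroup_apply]

/-- At `t` the conjugated operator acts by the coefficient of `π̃(b)` at `s⁻¹ * t`, and
`α_{(s⁻¹t)⁻¹}(b) = α_{t⁻¹}(α_s(b))`. -/
theorem regularGroup_covariant (α : Γ →* (B ≃⋆ₐ[ℂ] B)) (π : B →⋆ₐ[ℂ] (K →L[ℂ] K)) (s : Γ)
    (b : B) : regularGroup s * regularCoeff α π b * star (regularGroup (K := K) s) =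
      regularCoeff α π (α s b) := by
  rw [star_regularGroup]
  ext ξ t
  simp [regularGroup_apply, regularCoeff_apply]

/-- The canonical map from `B` to the reduced crossed product. -/
def reducedCanonicalMap (α : Γ →* (B ≃⋆ₐ[ℂ] B)) (π : B →⋆ₐ[ℂ] (K →L[ℂ] K)) :
    B →⋆ₐ[ℂ] ReducedCrossedProduct α π :=
  (regularCoeffHom α π).codRestrict _ fun b =>
    StarSubalgebra.le_topologicalClosure _
      (StarAlgebra.subset_adjoin ℂ _ (Or.inl (Set.mem_range_self b)))

/-- The canonical homomorphism from `Γ` to the unitary group of the reduced crossed product. -/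
def reducedCanonicalUnitary (α : Γ →* (B ≃⋆ₐ[ℂ] B)) (π : B →⋆ₐ[ℂ] (K →L[ℂ] K)) :
    Γ →* unitary (ReducedCrossedProduct α π) :=
  unitaryHom (reducedCrossedProduct α π) regularGroup regularGroup_one regularGroup_mul
    star_regularGroup fun t => StarSubalgebra.le_topologicalClosure _
      (StarAlgebra.subset_adjoin ℂ _ (Or.inr (Set.mem_range_self t)))

theorem isGeneratingCovariantPair_reduced (α : Γ →* (B ≃⋆ₐ[ℂ] B)) (π : B →⋆ₐ[ℂ] (K →L[ℂ] K)) :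
    IsGeneratingCovariantPair α (reducedCanonicalMap α π) (reducedCanonicalUnitary α π) :=
  .of_le_topologicalClosure (fun t b => Subtype.ext (regularGroup_covariant α π t b)) le_rfl

end Reduced

end StrongT

end

theorem mainTheorem4 {Γ : Type u} [Group Γ] {B : Type v} [CStarAlgebra B]
    (α : Γ →* (B ≃⋆ₐ[ℂ] B)) (hΓ : StrongT.GroupPropertyT.{u, w} Γ) :
    StrongT.StronglyCoRigid.{max (u + 1) (v + 1), w}
        (StrongT.FullCrossedProduct α) (StrongT.coefficientAlgebra α) ∧
      (StrongT.StrongPropertyT.{v, w} B →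
        StrongT.StrongPropertyT.{max (u + 1) (v + 1), w} (StrongT.FullCrossedProduct α) ∧
        ∀ (K : Type x) [NormedAddCommGroup K] [InnerProductSpace ℂ K] [CompleteSpace K]
          (π : B →⋆ₐ[ℂ] (K →L[ℂ] K)), Function.Injective π →
            StrongT.StrongPropertyT.{max u x, w} (StrongT.ReducedCrossedProduct α π)) := by
  have hfull := StrongT.isGeneratingCovariantPair_full α
  exact ⟨hfull.stronglyCoRigid hΓ, fun hB => ⟨hfull.strongPropertyT hΓ hB,
    fun _ _ _ _ π _ => (StrongT.isGeneratingCovariantPair_reduced α π).strongPropertyT hΓ hB⟩⟩
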